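/- Let $q$ be a prime power, $F=\mathrm{GF}(q)$, $m\ge 2$ and $\epsilon\in\{+,-\}$. Let $V=F^{2m}$ and let $\kappa:V\to F$ be a quadratic form with associated bilinear form $f(x,y)=\kappa(x+y)-\kappa(x)-\kappa(y)$. Assume that $\kappa$ is non-singular, i.e. the only $x\in V$ with $\kappa(x)=0$ and $f(x,y)=0$ for all $y\in V$ is $x=0$, and that $\kappa$ is of type $\epsilon$, i.e. the largest dimension of a subspace of $V$ on which $\kappa$ vanishes identically is $m$ if $\epsilon=+$ and $m-1$ if $\epsilon=-$. The affine polar graph $VO^{\epsilon}_{2m}(q)$ has vertex set $V$, two distinct vertices $u,v$ being adjacent if and only if $\kappa(u-v)=0$. Let $\Gamma O^{\epsilon}_{2m}(q)$ be the group of all semisimilarities of $\kappa$, that is, of all bijective semilinear maps $\phi:V\to V$ for which there are $\lambda\in F^{\times}$ and $\alpha\in\mathrm{Aut}(F)$ with $\kappa(\phi(x))=\lambda\,\alpha(\kappa(x))$ for all $x\in V$. Then $$\mathrm{Aut}(VO^{\epsilon}_{2m}(q)) = F^{2m}\rtimes \Gamma O^{\epsilon}_{2m}(q),$$ where $F^{2m}$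 acts on the vertex set by translations and $\Gamma O^{\epsilon}_{2m}(q)$ acts naturally. That is, sending $(v,\phi)$ to the map $x\mapsto \phi(x)+v$ is an isomorphism from the semidirect product, formed with respect to the natural action of $\Gamma O^{\epsilon}_{2m}(q)$ on $V$, onto the automorphism group of the graph. -/

import Mathlib

namespace AffinePolar

variable {F V : Type*} [Field F] [AddCommGroup V] [Module F V]

/-- The two types of non-singular quadratic forms on an even-dimensional space over a finite field:
`plus` (hyperbolic) and `minus` (elliptic). -/
inductive FormSign
  | plus
  | minus

/-- The Witt index of a non-singular form of type `ε` on a space of dimension `2 * m`, `m ≥ 1`. -/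
def FormSign.wittIndex (m : ℕ) : FormSign → ℕ
  | .plus => m
  | .minus => m - 1

/-- A subspace is totally singular for `κ` if `κ` vanishes identically on it. -/
def IsTotallySingular (κ : QuadraticForm F V) (W : Submodule F V) : Prop :=
  ∀ w ∈ W, κ w = 0

/-- `κ` has Witt index `k`: the largest dimension of a totally singular subspace is `k`. -/
def HasWittIndex (κ : QuadraticForm F V) (k : ℕ) : Prop :=
  IsGreatest {d : ℕ | ∃ W : Submodule F V, IsTotallySingular κ W ∧ Module.finrank F W = d} k

/-- `κ` is a non-singular quadratic form of type `ε` on a space of dimension `2 * m`.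
`κ.radical` is the set of all `x` with `κ x = 0` in the radical of the polar form of `κ`. -/
structure IsNonsingularOfType (κ : QuadraticForm F V) (m : ℕ) (ε : FormSign) : Prop where
  finrank_eq : Module.finrank F V = 2 * m
  radical_eq_bot : κ.radical = ⊥
  wittIndex : HasWittIndex κ (ε.wittIndex m)

/-- The graph on the vectors of `V` in which two distinct `u`, `v` are joined if `κ (u - v) = 0`.
It is the affine polar graph when `κ` is non-singular on a space of dimension `2 * m`. -/
def affinePolarGraph (κ : QuadraticForm F V) : SimpleGraph V where
  Adj u v := u ≠ v ∧ κ (u - v) = 0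
  symm := ⟨fun u v h => ⟨h.1.symm, by rw [← neg_sub, QuadraticMap.map_neg]; exact h.2⟩⟩
  loopless := ⟨fun _ h => h.1 rfl⟩

variable (F V) in
/-- `ΓL(V)`: the group of all bijective semilinear maps `V → V`, as permutations of `V`;
the field automorphism `σ` may vary with the map. -/
def semilinearGroup : Subgroup (Equiv.Perm V) where
  carrier := {g | (∀ x y, g (x + y) = g x + g y) ∧
    ∃ σ : F ≃+* F, ∀ (c : F) (x : V), g (c • x) = σ c • g x}
  one_mem' := ⟨fun _ _ => rfl, RingEquiv.refl F, fun _ _ => rfl⟩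
  mul_mem' := by
    rintro g h ⟨hg, σ, hσ⟩ ⟨hh, τ, hτ⟩
    exact ⟨fun x y => by simp [hg, hh], τ.trans σ, fun c x => by simp [hσ, hτ]⟩
  inv_mem' := by
    rintro g ⟨hg, σ, hσ⟩
    refine ⟨fun x y => ?_, σ.symm, fun c x => ?_⟩
    · rw [Equiv.Perm.inv_eq_iff_eq]; simp [hg]
    · rw [Equiv.Perm.inv_eq_iff_eq]; simp [hσ]

/-- The group of all semisimilarities of `κ`: the `g ∈ ΓL(V)` for which there are `l ∈ Fˣ` and a
field automorphism `α` with `κ (g x) = l * α (κ x)` for all `x`. It is `ΓO^ε_{2m}(q)` when `κ` is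
non-singular of type `ε` on a space of dimension `2 * m` over the field with `q` elements. -/
def semisimilarityGroup (κ : QuadraticForm F V) : Subgroup (Equiv.Perm V) where
  carrier := {g | g ∈ semilinearGroup F V ∧
    ∃ (l : Fˣ) (α : F ≃+* F), ∀ x : V, κ (g x) = l * α (κ x)}
  one_mem' := ⟨one_mem _, 1, RingEquiv.refl F, fun x => by simp⟩
  mul_mem' := by
    rintro g h ⟨hg, l, α, hα⟩ ⟨hh, k, β, hβ⟩
    refine ⟨mul_mem hg hh, l * Units.map (α : F →* F) k, β.trans α, fun x => ?_⟩
    simp [hα, hβ, mul_assoc]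
  inv_mem' := by
    rintro g ⟨hg, l, α, hα⟩
    refine ⟨inv_mem hg, Units.map (α.symm : F →* F) l⁻¹, α.symm, fun x => ?_⟩
    have h := hα (g⁻¹ x)
    rw [show g (g⁻¹ x) = x from g.apply_symm_apply x] at h
    simp [h, -Equiv.Perm.coe_inv]

/-- The natural action of the semisimilarity group on the additive group of `V`
(written multiplicatively), through which the semidirect product is formed. -/
def semisimilarityAction (κ : QuadraticForm F V) :
    semisimilarityGroup κ →* MulAut (Multiplicative V) where
  toFun g :=
    { toFun := fun v => Multiplicative.ofAdd (g.1 v.toAdd)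
      invFun := fun v => Multiplicative.ofAdd (g.1.symm v.toAdd)
      left_inv := fun v => by simp
      right_inv := fun v => by simp
      map_mul' := fun v w => by simp [g.2.1.1] }
  map_one' := rfl
  map_mul' _ _ := rfl

end AffinePolar

/-! After a translation it suffices to treat a graph automorphism `φ` fixing `0`. The graph
determines the lines with singular direction (`exists_eq_add_smul_iff`) and orthogonality to such a
direction (`polar_eq_zero_iff_forall`), so `φ` preserves both. The hyperplanes orthogonal to
parallel singular lines are parallel, which forces parallel images; hence parallelograms with
independent singular sides go to parallelograms. Singular vectors generate `V` additively, so `φ` is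
additive (`image_add`).

On a hyperbolic pair `x`, `y` the map `φ` then acts through scalar functions. Preservation of
singular vectors makes the one on `x` multiplicative on squares; squares generate `F` additively, so
it is a field automorphism, and it governs all of `V` (`exists_semisimilarity`).

The condition `2 ≤ m` supplies nonzero singular vectors and room outside a hyperbolic plane; even
dimension makes the polar form nondegenerate, even in characteristic 2. -/

namespace AffinePolar

open QuadraticMap

/-! ### Nondegeneracy of the polar form -/

section Polarity

variable {F V : Type*} [Field F] [AddCommGroup V] [Module F V]

/-- A totally isotropic subspace that is maximal among these equals its own orthogonal. -/
theorem exists_eq_orthogonal_self [FiniteDimensional F V] {B : LinearMap.BilinForm F V}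
    (hB : B.IsAlt) : ∃ W : Submodule F V, B.orthogonal W = W := by
  obtain ⟨W, hW, hmax⟩ := (wellFounded_gt (α := Submodule F V)).has_min
    {W | W ≤ B.orthogonal W} ⟨⊥, show ⊥ ≤ B.orthogonal ⊥ from bot_le⟩
  refine ⟨W, le_antisymm (fun v hv => ?_) hW⟩
  by_contra hvW
  have hlt : W < W ⊔ Submodule.span F {v} := by
    refine lt_of_le_of_ne le_sup_left fun h => hvW ?_
    rw [h]
    exact Submodule.mem_sup_right (Submodule.mem_span_singleton_self v)
  refine hmax _ ?_ hlt
  intro a ha b hb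
  obtain ⟨w, hw, c, rfl⟩ : ∃ w ∈ W, ∃ c : F, w + c • v = a := by
    simpa [Submodule.mem_sup, Submodule.mem_span_singleton] using ha
  obtain ⟨w', hw', c', rfl⟩ : ∃ w ∈ W, ∃ c : F, w + c • v = b := by
    simpa [Submodule.mem_sup, Submodule.mem_span_singleton] using hb
  have h1 : B w' w = 0 := hW hw w' hw'
  have h2 : B w' v = 0 := hv w' hw'
  have h3 : B v w = 0 := hB.isRefl _ _ (hv w hw)
  simp [h1, h2, h3, hB.self_eq_zero v]

/-- A self-orthogonal `W` contains the radical, so the dimension formula for `W` and its orthogonal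
makes the sum `2 * dim W`. -/
theorem even_finrank_add_finrank_radical [FiniteDimensional F V] {B : LinearMap.BilinForm F V}
    (hB : B.IsAlt) : Even (Module.finrank F V + Module.finrank F (B.orthogonal ⊤)) := by
  obtain ⟨W, hW⟩ := exists_eq_orthogonal_self hB
  have h := LinearMap.BilinForm.finrank_add_finrank_orthogonal hB.isRefl W
  have hle : B.orthogonal ⊤ ≤ W := hW ▸ LinearMap.BilinForm.orthogonal_le le_top
  rw [hW, inf_eq_right.mpr hle] at h
  exact ⟨_, h.symm⟩

/-- Over a finite field, a quadratic form with trivial radical on a space of even dimension has a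
nondegenerate polar form. -/
theorem eq_zero_of_polar_eq_zero [Finite F] [FiniteDimensional F V] {κ : QuadraticForm F V}
    (hκ : κ.radical = ⊥) (heven : Even (Module.finrank F V)) {r : V}
    (hr : ∀ y, polar κ r y = 0) : r = 0 := by
  have hsing : ∀ s, (∀ y, polar κ s y = 0) → κ s = 0 → s = 0 := fun s hs h0 => by
    have : s ∈ κ.radical := ⟨h0, LinearMap.ext fun y => hs y⟩
    simpa [hκ] using this
  by_cases h2 : (2 : F) = 0
  · by_contra hr0
    have hκr : κ r ≠ 0 := fun h => hr0 (hsing r hr h)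
    have hchar : CharP F 2 := CharTwo.of_one_ne_zero_of_two_eq_zero one_ne_zero h2
    have halt : (polarBilin κ).IsAlt := fun x => by
      simp [CharTwo.two_eq_zero]
    -- Every scalar is a square, so any radical vector `s` can be corrected by a multiple of `r` to
    -- have `κ = 0`. The radical is thus a line, which contradicts parity.
    have hspan : LinearMap.BilinForm.orthogonal (polarBilin κ) ⊤ = Submodule.span F {r} := by
      ext s
      rw [Submodule.mem_span_singleton]
      constructor
      · intro hs
        have hs' : ∀ y, polar κ s y = 0 := fun y => by
          rw [polar_comm]; exact hs y trivial
        obtain ⟨c, hc⟩ := FiniteField.isSquare_of_char_two (ringChar.eq F 2) (κ s / κ r)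
        refine ⟨c, ?_⟩
        rw [eq_comm, ← sub_eq_zero]
        refine hsing _ (fun y => by simp [polar_sub_left, polar_smul_left, hs', hr]) ?_
        rw [sub_eq_add_neg, ← neg_smul, QuadraticMap.map_add κ, QuadraticMap.map_smul, hs']
        field_simp at hc
        simp only [smul_eq_mul, neg_mul_neg, add_zero]
        linear_combination hc + c * c * κ r * h2
      · rintro ⟨c, rfl⟩ y -
        simp [polar_comm κ y r, hr]
    have h := even_finrank_add_finrank_radical halt
    rw [hspan, finrank_span_singleton hr0] at h
    exact absurd h (by simpa [Nat.even_add_one] using heven)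
  · refine hsing r hr ?_
    have := hr r
    rw [polar_self] at this
    simpa [h2] using this

/-- By nondegeneracy, a functional killing `x` but not `z` is represented by a vector. -/
theorem exists_polar_eq_zero_and_eq_one [FiniteDimensional F V] {κ : QuadraticForm F V}
    (hκ : ∀ x, (∀ y, polar κ x y = 0) → x = 0) {x z : V} (hz : ∀ c : F, z ≠ c • x) :
    ∃ v, polar κ x v = 0 ∧ polar κ z v = 1 := by
  have hz' : z ∉ Submodule.span F {x} := fun h => by
    obtain ⟨c, hc⟩ := Submodule.mem_span_singleton.mp h
    exact hz c hc.symm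
  obtain ⟨g, hgz, hg⟩ := Submodule.exists_dual_map_eq_bot_of_notMem hz' inferInstance
  have hgx : g x = 0 := by
    have : g x ∈ (Submodule.span F {x}).map g :=
      Submodule.mem_map_of_mem (Submodule.mem_span_singleton_self x)
    simpa [hg] using this
  have hinj : Function.Injective (polarBilin κ) :=
    (injective_iff_map_eq_zero _).mpr fun a ha => hκ a fun y => by
      simpa using LinearMap.congr_fun ha y
  obtain ⟨v, hv⟩ := (LinearMap.injective_iff_surjective_of_finrank_eq_finrank
    (Subspace.dual_finrank_eq (K := F) (V := V)).symm).mp hinj g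
  have hv' : ∀ y, polar κ y v = g y := fun y => by
    rw [polar_comm, ← hv]; rfl
  exact ⟨(g z)⁻¹ • v, by simp [polar_smul_right, hv', hgx],
    by simp [polar_smul_right, hv', hgz]⟩

/-- Two independent vectors have prescribed products with some vector. -/
theorem exists_polar_eq_and_eq [FiniteDimensional F V] {κ : QuadraticForm F V}
    (hκ : ∀ x, (∀ y, polar κ x y = 0) → x = 0) {x z : V} (hx : x ≠ 0) (hz : ∀ c : F, z ≠ c • x)
    (a b : F) : ∃ v, polar κ x v = a ∧ polar κ z v = b := by
  obtain ⟨v, hxv, hzv⟩ := exists_polar_eq_zero_and_eq_one hκ hz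
  have hx' : ∀ c : F, x ≠ c • z := by
    rintro c rfl
    have hc : c ≠ 0 := by rintro rfl; simp at hx
    exact hz c⁻¹ (by simp [smul_smul, hc])
  obtain ⟨w, hzw, hxw⟩ := exists_polar_eq_zero_and_eq_one hκ hx'
  exact ⟨a • w + b • v, by simp [polar_add_right, polar_smul_right, *],
    by simp [polar_add_right, polar_smul_right, *]⟩

theorem exists_polar_eq_one [FiniteDimensional F V] {κ : QuadraticForm F V}
    (hκ : ∀ x, (∀ y, polar κ x y = 0) → x = 0) {x : V} (hx : x ≠ 0) : ∃ v, polar κ x v = 1 := by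
  obtain ⟨v, -, h⟩ := exists_polar_eq_zero_and_eq_one hκ (x := 0) (z := x) (by simpa using hx)
  exact ⟨v, h⟩

end Polarity

/-! ### Singular vectors and singular lines -/

section Singular

variable {F V : Type*} [Field F] [AddCommGroup V] [Module F V] {κ : QuadraticForm F V}

theorem map_sub_eq (κ : QuadraticForm F V) (a b : V) : κ (a - b) = κ a + κ b - polar κ a b := by
  rw [sub_eq_add_neg, QuadraticMap.map_add κ, QuadraticMap.map_neg, polar_neg_right]
  ring

theorem map_sub_smul_of_singular {x : V} (hx : κ x = 0) (z : V) (c : F) :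
    κ (z - c • x) = κ z - c * polar κ z x := by
  rw [map_sub_eq, QuadraticMap.map_smul, hx, polar_smul_right]
  simp

theorem map_smul_add_smul_add {x y w : V} (hx : κ x = 0) (hy : κ y = 0) (hxw : polar κ x w = 0)
    (hyw : polar κ y w = 0) (a b : F) :
    κ (a • x + b • y + w) = a * b * polar κ x y + κ w := by
  simp [QuadraticMap.map_add, QuadraticMap.map_smul, polar_add_left, polar_smul_left,
    polar_smul_right, hx, hy, hxw, hyw]
  ring

/-- The points of the line through `u` and `u + x` are the vertices adjacent or equal to all common
neighbours of `u` and `u + x`. -/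
theorem exists_eq_add_smul_iff [FiniteDimensional F V]
    (hκ : ∀ x, (∀ y, polar κ x y = 0) → x = 0) {x : V} (hx : κ x = 0) (u z : V) :
    (∃ c : F, z = u + c • x) ↔
      ∀ w, κ (w - u) = 0 → κ (w - (u + x)) = 0 → κ (w - z) = 0 := by
  constructor
  · rintro ⟨c, rfl⟩ w h1 h2
    have h3 := map_sub_smul_of_singular hx (w - u) 1
    rw [one_smul, sub_sub, h1, h2] at h3
    rw [← sub_sub, map_sub_smul_of_singular hx, h1]
    linear_combination -c * h3
  · intro h
    obtain ⟨z, rfl⟩ : ∃ z', z = u + z' := ⟨z - u, by abel⟩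
    have h0 : κ z = 0 := by
      simpa [QuadraticMap.map_neg] using h u (by simp) (by simp [QuadraticMap.map_neg, hx])
    have h1 : polar κ z x = 0 := by
      have h2 := h (u + x) (by simpa using hx) (by simp)
      rw [add_sub_add_left_eq_sub, map_sub_eq, hx, h0, polar_comm] at h2
      simpa using h2
    by_contra! hc
    obtain ⟨y, hy1, hy2⟩ := exists_polar_eq_zero_and_eq_one hκ (x := x) (z := z)
      fun c hc' => hc c (by rw [hc'])
    -- Subtracting `κ y • z` makes `y` singular and keeps it orthogonal to `x`, while its product
    -- with `z` stays `1`; this common neighbour is not adjacent to `u + z`.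
    have h3 := h (u + (y - κ y • z))
      (by
        rw [add_sub_cancel_left, map_sub_smul_of_singular h0, polar_comm κ y z, hy2]
        ring)
      (by
        rw [add_sub_add_left_eq_sub, map_sub_eq, map_sub_smul_of_singular h0, polar_comm κ y z,
          hy2, hx, polar_sub_left, polar_smul_left, h1, polar_comm κ y x, hy1]
        simp)
    rw [add_sub_add_left_eq_sub, map_sub_eq, map_sub_smul_of_singular h0, polar_comm κ y z, hy2,
      h0, polar_sub_left, polar_smul_left, polar_self, polar_comm κ y z, hy2, h0] at h3
    simp at h3

/-- Along a singular direction `κ` is affine in the parameter, with slope given by the polar form: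
if the slope is nonzero, exactly one point of the line is singular. -/
theorem polar_eq_zero_iff_forall {x : V} (hx : κ x = 0) (z : V) :
    polar κ z x = 0 ↔ ∀ c : F, κ (z - c • x) = 0 ↔ κ z = 0 := by
  simp only [map_sub_smul_of_singular hx]
  constructor
  · intro h c
    simp [h]
  · intro h
    by_contra h0
    have h1 : κ z = 0 := (h (κ z / polar κ z x)).mp (by field_simp; ring)
    have := (h 1).mpr h1
    simp [h1, h0] at this

/-- Decomposition along a hyperbolic pair. -/
theorem exists_eq_smul_add_smul_add {x y : V} (hx : κ x = 0) (hy : κ y = 0)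
    (hxy : polar κ x y ≠ 0) (v : V) :
    ∃ (a b : F) (w : V), polar κ x w = 0 ∧ polar κ y w = 0 ∧ v = a • x + b • y + w := by
  refine ⟨polar κ y v / polar κ x y, polar κ x v / polar κ x y,
    v - (polar κ y v / polar κ x y) • x - (polar κ x v / polar κ x y) • y, ?_, ?_, by abel⟩
  · simp only [polar_sub_right, polar_smul_right, polar_self, hx, smul_eq_mul]
    field_simp
    simp
  · simp only [polar_sub_right, polar_smul_right, polar_self, hy, polar_comm κ y x, smul_eq_mul]
    field_simp
    simp

end Singular

/-! ### Hyperbolic pairs and generation by singular vectors -/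

section Hyperbolic

variable {F V : Type*} [Field F] [AddCommGroup V] [Module F V] [FiniteDimensional F V]
  {κ : QuadraticForm F V}

theorem exists_singular_polar_eq_one (hκ : ∀ x, (∀ y, polar κ x y = 0) → x = 0) {x : V}
    (hx : κ x = 0) (hx0 : x ≠ 0) : ∃ y, κ y = 0 ∧ polar κ x y = 1 := by
  obtain ⟨v, hv⟩ := exists_polar_eq_one hκ hx0
  refine ⟨v - κ v • x, ?_, ?_⟩
  · rw [map_sub_smul_of_singular hx, polar_comm κ v x, hv]
    ring
  · simp [polar_sub_right, polar_smul_right, polar_self, hx, hv]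

/-- A vector outside the hyperbolic plane has a nonzero component orthogonal to it; a partner for
that component can be projected in the same way. -/
theorem exists_polar_eq_one_orthogonal (hκ : ∀ x, (∀ y, polar κ x y = 0) → x = 0)
    (hdim : 2 < Module.finrank F V) {x y : V} (hx : κ x = 0) (hy : κ y = 0)
    (hxy : polar κ x y ≠ 0) :
    ∃ w₁ w₂, polar κ x w₁ = 0 ∧ polar κ y w₁ = 0 ∧ polar κ x w₂ = 0 ∧ polar κ y w₂ = 0 ∧
      polar κ w₁ w₂ = 1 := by
  obtain ⟨v, -, hv⟩ : ∃ v ∈ (⊤ : Submodule F V), v ∉ Submodule.span F {x, y} := by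
    apply SetLike.exists_of_lt
    rw [lt_top_iff_ne_top]
    intro h
    classical
    have h1 := finrank_span_finset_le_card (R := F) ({x, y} : Finset V)
    have h2 := Finset.card_le_two (a := x) (b := y)
    rw [Finset.coe_pair, Set.finrank, h, finrank_top] at h1
    omega
  obtain ⟨a, b, w₁, h1, h2, rfl⟩ := exists_eq_smul_add_smul_add hx hy hxy v
  have hw : w₁ ≠ 0 := by
    rintro rfl
    exact hv (Submodule.mem_span_pair.mpr ⟨a, b, by simp⟩)
  obtain ⟨v', hv'⟩ := exists_polar_eq_one hκ hw
  obtain ⟨a', b', w₂, h3, h4, rfl⟩ := exists_eq_smul_add_smul_add hx hy hxy v'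
  refine ⟨w₁, w₂, h1, h2, h3, h4, ?_⟩
  simpa [polar_add_right, polar_smul_right, polar_comm κ w₁ x, polar_comm κ w₁ y, h1, h2] using hv'

theorem exists_map_ne_zero_orthogonal (hκ : ∀ x, (∀ y, polar κ x y = 0) → x = 0)
    (hdim : 2 < Module.finrank F V) {x y : V} (hx : κ x = 0) (hy : κ y = 0)
    (hxy : polar κ x y ≠ 0) :
    ∃ w, polar κ x w = 0 ∧ polar κ y w = 0 ∧ κ w ≠ 0 := by
  obtain ⟨w₁, w₂, h1, h2, h3, h4, h⟩ := exists_polar_eq_one_orthogonal hκ hdim hx hy hxy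
  by_contra! h0
  have h5 := h0 (w₁ + w₂) (by simp [polar_add_right, *]) (by simp [polar_add_right, *])
  rw [QuadraticMap.map_add κ, h0 w₁ h1 h2, h0 w₂ h3 h4, h] at h5
  simp at h5

/-- The singular vectors outside the line of a given singular vector generate the space. -/
theorem eq_top_of_singular_mem (hκ : ∀ x, (∀ y, polar κ x y = 0) → x = 0)
    (hdim : 2 < Module.finrank F V) {x : V} (hx : κ x = 0) (hx0 : x ≠ 0) (T : AddSubgroup V)
    (hT : ∀ z, κ z = 0 → (∀ c : F, z ≠ c • x) → z ∈ T) : T = ⊤ := by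
  obtain ⟨y, hy, hxy⟩ := exists_singular_polar_eq_one hκ hx hx0
  have hmem : ∀ (a b : F) (w : V), b ≠ 0 → polar κ x w = 0 → polar κ y w = 0 → a * b + κ w = 0 →
      a • x + b • y + w ∈ T := by
    intro a b w hb hxw hyw h
    refine hT _ (by rw [map_smul_add_smul_add hx hy hxw hyw, hxy, mul_one, h]) fun c hc => hb ?_
    have := congrArg (polar κ x) hc
    simpa [polar_add_right, polar_smul_right, polar_self, hx, hxw, hxy] using this
  have hyT : ∀ b : F, b • y ∈ T := by
    intro b
    by_cases hb : b = 0
    · simp [hb]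
    · simpa using hmem 0 b 0 hb (by simp) (by simp) (by simp)
  have hwT : ∀ w, polar κ x w = 0 → polar κ y w = 0 → w - κ w • x ∈ T := by
    intro w hxw hyw
    have := T.sub_mem (hmem (-κ w) 1 w one_ne_zero hxw hyw (by ring)) (hyT 1)
    convert this using 1
    module
  obtain ⟨w₁, w₂, h1, h2, h3, h4, h⟩ :=
    exists_polar_eq_one_orthogonal hκ hdim hx hy (by simp [hxy])
  -- `w ↦ w - κ w • x` fails to be additive by the polar form, and the pair `a • w₁`, `w₂` makes
  -- this defect exactly `a • x`.
  have hxT : ∀ a : F, a • x ∈ T := by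
    intro a
    have e := T.sub_mem (T.add_mem (hwT (a • w₁) (by simp [polar_smul_right, h1])
      (by simp [polar_smul_right, h2])) (hwT w₂ h3 h4))
      (hwT (a • w₁ + w₂) (by simp [polar_add_right, polar_smul_right, h1, h3])
        (by simp [polar_add_right, polar_smul_right, h2, h4]))
    convert e using 1
    rw [QuadraticMap.map_add κ, polar_smul_left, h, smul_eq_mul]
    module
  rw [eq_top_iff]
  intro v _
  obtain ⟨a, b, w, hxw, hyw, rfl⟩ := exists_eq_smul_add_smul_add hx hy (by simp [hxy]) v
  have := T.add_mem (hwT w hxw hyw) (hxT (κ w))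
  rw [sub_add_cancel] at this
  exact T.add_mem (T.add_mem (hxT a) (hyT b)) this

end Hyperbolic

/-! ### Automorphisms fixing zero are additive -/

section Additive

variable {F V : Type*} [Field F] [AddCommGroup V] [Module F V] [FiniteDimensional F V]
  {κ : QuadraticForm F V} {φ : Equiv.Perm V}

theorem exists_eq_add_smul_iff_image (hκ : ∀ x, (∀ y, polar κ x y = 0) → x = 0)
    (hφ : ∀ u v, κ (φ u - φ v) = 0 ↔ κ (u - v) = 0) {x : V} (hx : κ x = 0) (u z : V) :
    (∃ c : F, z = u + c • x) ↔ ∃ c : F, φ z = φ u + c • (φ (u + x) - φ u) := by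
  have hx' : κ (φ (u + x) - φ u) = 0 := (hφ _ _).mpr (by simpa using hx)
  rw [exists_eq_add_smul_iff hκ hx, exists_eq_add_smul_iff hκ hx', add_sub_cancel,
    ← φ.forall_congr_right
      (q := fun w => κ (w - φ u) = 0 → κ (w - φ (u + x)) = 0 → κ (w - φ z) = 0)]
  simp only [hφ]

theorem polar_eq_zero_iff_image (hκ : ∀ x, (∀ y, polar κ x y = 0) → x = 0)
    (hφ : ∀ u v, κ (φ u - φ v) = 0 ↔ κ (u - v) = 0) {x : V} (hx : κ x = 0) (u z : V) :
    polar κ (φ z - φ u) (φ (u + x) - φ u) = 0 ↔ polar κ (z - u) x = 0 := by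
  have hx' : κ (φ (u + x) - φ u) = 0 := (hφ _ _).mpr (by simpa using hx)
  rw [polar_eq_zero_iff_forall hx, polar_eq_zero_iff_forall hx']
  simp only [hφ, sub_sub]
  constructor
  · intro h c
    obtain ⟨d, hd⟩ := (exists_eq_add_smul_iff_image hκ hφ hx u (u + c • x)).mp ⟨c, rfl⟩
    have := h d
    rwa [← hd, hφ] at this
  · intro h c
    obtain ⟨p, hp⟩ := φ.surjective (φ u + c • (φ (u + x) - φ u))
    obtain ⟨d, hd⟩ := (exists_eq_add_smul_iff_image hκ hφ hx u p).mpr ⟨c, hp⟩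
    rw [← hp, hφ, hd]
    exact h d

/-- Parallel singular lines have parallel images. -/
theorem exists_image_sub_eq_smul (hκ : ∀ x, (∀ y, polar κ x y = 0) → x = 0)
    (hφ : ∀ u v, κ (φ u - φ v) = 0 ↔ κ (u - v) = 0) {x : V} (hx : κ x = 0) (hx0 : x ≠ 0)
    (u v : V) : ∃ c : F, φ (v + x) - φ v = c • (φ (u + x) - φ u) := by
  by_contra! h
  have hne : φ (u + x) - φ u ≠ 0 := by simpa [sub_eq_zero] using hx0
  -- If the image directions were independent, membership in the two image hyperplanes could be
  -- prescribed separately; but their preimages are parallel, so once they meet they coincide.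
  have key : ∀ a b : F, ∃ z,
      (polar κ (z - u) x = 0 ↔ a = 0) ∧ (polar κ (z - v) x = 0 ↔ b = 0) := by
    intro a b
    obtain ⟨z', h1, h2⟩ := exists_polar_eq_and_eq hκ hne h
      (a + polar κ (φ (u + x) - φ u) (φ u)) (b + polar κ (φ (v + x) - φ v) (φ v))
    obtain ⟨z, rfl⟩ := φ.surjective z'
    refine ⟨z, ?_, ?_⟩
    · rw [← polar_eq_zero_iff_image hκ hφ hx, polar_comm, polar_sub_right, h1, add_sub_cancel_right]
    · rw [← polar_eq_zero_iff_image hκ hφ hx, polar_comm, polar_sub_right, h2, add_sub_cancel_right]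
  obtain ⟨p, hp1, hp2⟩ := key 0 0
  obtain ⟨r, hr1, hr2⟩ := key 0 1
  have e1 : polar κ p x = polar κ u x := by
    simpa [polar_sub_left, sub_eq_zero] using hp1
  have e2 : polar κ p x = polar κ v x := by
    simpa [polar_sub_left, sub_eq_zero] using hp2
  have e3 : polar κ r x = polar κ u x := by
    simpa [polar_sub_left, sub_eq_zero] using hr1
  have e4 : polar κ r x ≠ polar κ v x := by
    simpa [polar_sub_left, sub_eq_zero] using hr2
  exact e4 (by rw [e3, ← e1, e2])

/-- The image quadrilateral has parallel opposite sides in independent directions; comparing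
coefficients shows that it is a parallelogram. -/
theorem image_sub_eq_of_not_parallel (hκ : ∀ x, (∀ y, polar κ x y = 0) → x = 0)
    (hφ : ∀ u v, κ (φ u - φ v) = 0 ↔ κ (u - v) = 0) {x y : V} (hx : κ x = 0) (hx0 : x ≠ 0)
    (hy : κ y = 0) (hyx : ∀ c : F, y ≠ c • x) (u : V) :
    φ (u + y + x) - φ (u + y) = φ (u + x) - φ u := by
  have hy0 : y ≠ 0 := by simpa using hyx 0
  obtain ⟨d, hd⟩ := exists_image_sub_eq_smul hκ hφ hx hx0 u (u + y)
  obtain ⟨e, he⟩ := exists_image_sub_eq_smul hκ hφ hy hy0 u (u + x)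
  have hind : ∀ c : F, φ (u + y) - φ u ≠ c • (φ (u + x) - φ u) := by
    intro c hc
    obtain ⟨c', hc'⟩ := (exists_eq_add_smul_iff_image hκ hφ hx u (u + y)).mpr
      ⟨c, by rw [← hc]; abel⟩
    exact hyx c' (add_left_cancel hc')
  have hsum : (1 - e) • (φ (u + y) - φ u) = (1 - d) • (φ (u + x) - φ u) := by
    rw [sub_smul, sub_smul, ← hd, ← he, add_right_comm u y x]
    module
  have he1 : 1 - e = 0 := by
    by_contra he0
    refine hind ((1 - e)⁻¹ * (1 - d)) ?_
    rw [mul_smul, ← hsum, smul_smul, inv_mul_cancel₀ he0, one_smul]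
  have hne : φ (u + x) - φ u ≠ 0 := by simpa [sub_eq_zero] using hx0
  rw [he1, zero_smul, eq_comm, smul_eq_zero_iff_left hne, sub_eq_zero] at hsum
  rw [hd, ← hsum, one_smul]

/-- The translations preserving the image difference along `x` form a subgroup containing every
singular vector off the line of `x`, hence everything. -/
theorem image_add_of_singular (hκ : ∀ x, (∀ y, polar κ x y = 0) → x = 0)
    (hdim : 2 < Module.finrank F V)
    (hφ : ∀ u v, κ (φ u - φ v) = 0 ↔ κ (u - v) = 0) (hφ0 : φ 0 = 0) {x : V} (hx : κ x = 0)
    (u : V) : φ (u + x) = φ u + φ x := by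
  by_cases hx0 : x = 0
  · simp [hx0, hφ0]
  let T : AddSubgroup V :=
    { carrier := {v | ∀ u, φ (u + v + x) - φ (u + v) = φ (u + x) - φ u}
      zero_mem' := by simp
      add_mem' := fun {a b} ha hb u => by rw [← add_assoc, hb, ha]
      neg_mem' := fun {a} ha u => by simpa using (ha (u + -a)).symm }
  have hT : T = ⊤ := eq_top_of_singular_mem hκ hdim hx hx0 T fun z hz hzx u =>
    image_sub_eq_of_not_parallel hκ hφ hx hx0 hz hzx u
  have hu : u ∈ T := hT ▸ AddSubgroup.mem_top u
  have := hu 0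
  simp only [zero_add, hφ0, sub_zero] at this
  rw [← this]
  abel

theorem image_add (hκ : ∀ x, (∀ y, polar κ x y = 0) → x = 0) (hdim : 2 < Module.finrank F V)
    (hsing : ∃ x, κ x = 0 ∧ x ≠ 0)
    (hφ : ∀ u v, κ (φ u - φ v) = 0 ↔ κ (u - v) = 0) (hφ0 : φ 0 = 0) (u v : V) :
    φ (u + v) = φ u + φ v := by
  obtain ⟨x, hx, hx0⟩ := hsing
  let T : AddSubgroup V :=
    { carrier := {v | ∀ u, φ (u + v) = φ u + φ v}
      zero_mem' := by simp [hφ0]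
      add_mem' := fun {a b} ha hb u => by rw [← add_assoc, hb, ha, hb, add_assoc]
      neg_mem' := fun {a} ha u => by
        have h1 := ha (u + -a)
        have h2 := ha (-a)
        simp only [neg_add_cancel, neg_add_cancel_right, hφ0] at h1 h2
        rw [h1, add_assoc, add_comm (φ a), ← h2, add_zero] }
  have hT : T = ⊤ := eq_top_of_singular_mem hκ hdim hx hx0 T fun z hz _ u =>
    image_add_of_singular hκ hdim hφ hφ0 hz u
  have hv : v ∈ T := hT ▸ AddSubgroup.mem_top v
  exact hv u

end Additive

/-! ### From additive to semisimilar -/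

section Semilinear

variable {F V : Type*} [Field F] [AddCommGroup V] [Module F V]

/-- Over a finite field, the squares generate the additive group. -/
theorem map_mul_of_map_sq_mul [Finite F] (f : F →+ F)
    (hf : ∀ c d, f (c ^ 2 * d) = f (c ^ 2) * f d) (a b : F) : f (a * b) = f a * f b := by
  by_cases h2 : (2 : F) = 0
  · have hchar : CharP F 2 := CharTwo.of_one_ne_zero_of_two_eq_zero one_ne_zero h2
    obtain ⟨c, rfl⟩ := FiniteField.isSquare_of_char_two (ringChar.eq F 2) a
    rw [← pow_two, hf]
  · have ha : a = ((a + 1) / 2) ^ 2 - ((a - 1) / 2) ^ 2 := by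
      field_simp
      ring
    rw [ha, sub_mul, map_sub, hf, hf, map_sub, sub_mul]

/-- An additive bijection that respects singular lines, singular vectors, and orthogonality to
singular vectors is a semisimilarity. -/
theorem exists_semisimilarity [Finite F] [FiniteDimensional F V] {κ : QuadraticForm F V}
    (hκ : ∀ x, (∀ y, polar κ x y = 0) → x = 0) (hdim : 2 < Module.finrank F V)
    (hsing : ∃ x, κ x = 0 ∧ x ≠ 0) (φ : V ≃+ V) (hφ : ∀ v, κ v = 0 → κ (φ v) = 0)
    (hpolar : ∀ x z, κ x = 0 → (polar κ (φ x) (φ z) = 0 ↔ polar κ x z = 0))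
    (hline : ∀ x, κ x = 0 → ∀ c : F, ∃ d : F, φ (c • x) = d • φ x) :
    ∃ (σ : F ≃+* F) (l : Fˣ), (∀ (c : F) v, φ (c • v) = σ c • φ v) ∧
      ∀ v, κ (φ v) = l * σ (κ v) := by
  obtain ⟨x, hx, hx0⟩ := hsing
  obtain ⟨y₀, hy₀, hxy₀⟩ := exists_singular_polar_eq_one hκ hx hx0
  obtain ⟨w₀, hxw₀, hyw₀, hw₀⟩ :=
    exists_map_ne_zero_orthogonal hκ hdim hx hy₀ (by simp [hxy₀])
  obtain ⟨t, ht⟩ : ∃ t, κ w₀ = t := ⟨_, rfl⟩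
  rw [ht] at hw₀
  -- Scaling `y` so that the product with `x` equals `κ w₀` lets the factor `t` cancel in the
  -- singular vectors used below.
  obtain ⟨y, hy, hxy, hyw₀⟩ : ∃ y, κ y = 0 ∧ polar κ x y = t ∧ polar κ y w₀ = 0 :=
    ⟨t • y₀, by simp [QuadraticMap.map_smul, hy₀], by simp [polar_smul_right, hxy₀],
      by simp [polar_smul_left, hyw₀]⟩
  choose s hs using hline x hx
  choose r hr using hline y hy
  obtain ⟨k, hk⟩ : ∃ k, polar κ (φ x) (φ y) = k := ⟨_, rfl⟩
  have hk0 : k ≠ 0 := by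
    rw [← hk, Ne, hpolar x y hx, hxy]
    exact hw₀
  have hφx : φ x ≠ 0 := by simpa using hx0
  have hφy : φ y ≠ 0 := by
    rintro h
    simp [h] at hk
    exact hk0 hk.symm
  have hs1 : s 1 = 1 := by
    have := hs 1
    rw [one_smul] at this
    exact smul_left_injective F hφx (by simp [← this])
  have hr1 : r 1 = 1 := by
    have := hr 1
    rw [one_smul] at this
    exact smul_left_injective F hφy (by simp [← this])
  have hsadd : ∀ a b, s (a + b) = s a + s b := fun a b =>
    smul_left_injective F hφx (by simp only [add_smul, ← hs, map_add])
  have hform : ∀ (a b : F) (w : V), polar κ x w = 0 → polar κ y w = 0 →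
      κ (φ (a • x + b • y + w)) = s a * r b * k + κ (φ w) := by
    intro a b w hxw hyw
    have e : φ (a • x + b • y + w) = s a • φ x + r b • φ y + φ w := by
      rw [map_add, map_add, hs, hr]
    rw [e, map_smul_add_smul_add (hφ x hx) (hφ y hy)
      ((hpolar x w hx).mpr hxw) ((hpolar y w hy).mpr hyw), hk]
  have hzero : ∀ (a b : F) (w : V), polar κ x w = 0 → polar κ y w = 0 → a * b * t + κ w = 0 →
      s a * r b * k + κ (φ w) = 0 := by
    intro a b w hxw hyw h
    rw [← hform a b w hxw hyw]
    exact hφ _ (by rw [map_smul_add_smul_add hx hy hxw hyw, hxy, h])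
  obtain ⟨f, hf⟩ : ∃ f : F →+ F, ∀ a, f a = s a := ⟨AddMonoidHom.mk' s hsadd, fun _ => rfl⟩
  -- The singular vectors with coordinates `(-c² / b, b)` and `(-c², 1)` share the component `c •
  -- w₀`, so its unknown image value cancels.
  have hsq : ∀ c b : F, b ≠ 0 → f (c ^ 2 * b⁻¹) * r b = f (c ^ 2) := by
    intro c b hb
    have hxw : polar κ x (c • w₀) = 0 := by simp [polar_smul_right, hxw₀]
    have hyw : polar κ y (c • w₀) = 0 := by simp [polar_smul_right, hyw₀]
    have hκw : κ (c • w₀) = c ^ 2 * t := by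
      rw [QuadraticMap.map_smul, ht, smul_eq_mul, pow_two]
    have h1 := hzero (-(c ^ 2 * b⁻¹)) b (c • w₀) hxw hyw (by rw [hκw]; field_simp; ring)
    have h2 := hzero (-(c ^ 2)) 1 (c • w₀) hxw hyw (by rw [hκw]; ring)
    rw [← hf, map_neg] at h1 h2
    rw [hr1] at h2
    refine mul_right_cancel₀ hk0 ?_
    linear_combination h2 - h1
  have hinv : ∀ b : F, b ≠ 0 → f b⁻¹ * r b = 1 := by
    intro b hb
    simpa [hf, hs1] using hsq 1 b hb
  have hmul : ∀ a b, f (a * b) = f a * f b := by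
    refine map_mul_of_map_sq_mul f fun c d => ?_
    by_cases hd : d = 0
    · simp [hd]
    have h1 := hsq c d⁻¹ (inv_ne_zero hd)
    have h2 := hinv d⁻¹ (inv_ne_zero hd)
    rw [inv_inv] at h1 h2
    linear_combination f d * h1 - f (c ^ 2 * d) * h2
  let ρ : F →+* F :=
    { f with
      map_one' := by simp [hf, hs1]
      map_mul' := hmul }
  let σ : F ≃+* F := RingEquiv.ofBijective ρ
    ⟨ρ.injective, Finite.injective_iff_surjective.mp ρ.injective⟩
  have hσs : ∀ a, s a = σ a := fun a => (hf a).symm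
  have hσr : ∀ b, r b = σ b := by
    intro b
    by_cases hb : b = 0
    · have := hr b
      rw [hb, zero_smul, map_zero, eq_comm, smul_eq_zero_iff_left hφy] at this
      rw [hb, this, map_zero]
    have h1 : σ b⁻¹ * r b = 1 := hinv b hb
    have h2 : σ b ≠ 0 := by simpa using hb
    rw [map_inv₀] at h1
    field_simp at h1
    exact h1
  simp only [hσs, hσr] at hs hr hform hzero
  -- Completing `w` to a singular vector makes `hline` apply; pairing with `φ x` identifies the
  -- scalar as `σ c`.
  have hw : ∀ (c : F) (w : V), polar κ x w = 0 → polar κ y w = 0 → φ (c • w) = σ c • φ w := by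
    intro c w hxw hyw
    obtain ⟨a, ha⟩ : ∃ a, a * t + κ w = 0 := ⟨-κ w / t, by field_simp; ring⟩
    have hz : κ (a • x + (1 : F) • y + w) = 0 := by
      rw [map_smul_add_smul_add hx hy hxw hyw, hxy, mul_one, ha]
    obtain ⟨d, hd⟩ := hline _ hz c
    have hφw := (hpolar x w hx).mpr hxw
    have hφcw : polar κ (φ x) (φ (c • w)) = 0 :=
      (hpolar x _ hx).mpr (by simp [polar_smul_right, hxw])
    simp only [smul_add, map_add, smul_smul, hs, hr, mul_one] at hd
    have h1 := congrArg (polar κ (φ x)) hd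
    simp only [polar_add_right, polar_smul_right, polar_self, hφ x hx, hk, hφw, hφcw, map_one,
      smul_zero, mul_zero, zero_add, add_zero, smul_eq_mul, mul_one] at h1
    rw [← mul_right_cancel₀ hk0 h1] at hd
    rw [map_mul, map_one, mul_one] at hd
    exact add_left_cancel hd
  have hst : σ t ≠ 0 := by simpa using hw₀
  -- The multiplier compares the products of the hyperbolic pair after and before `φ`.
  refine ⟨σ, Units.mk0 (k / σ t) (div_ne_zero hk0 hst), fun c v => ?_, fun v => ?_⟩
  · obtain ⟨a, b, w, hxw, hyw, rfl⟩ :=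
      exists_eq_smul_add_smul_add hx hy (by rw [hxy]; exact hw₀) v
    simp only [smul_add, map_add, smul_smul, hs, hr, hw c w hxw hyw, map_mul]
  · obtain ⟨a, b, w, hxw, hyw, rfl⟩ :=
      exists_eq_smul_add_smul_add hx hy (by rw [hxy]; exact hw₀) v
    have h1 := hzero (-κ w / t) 1 w hxw hyw (by field_simp; ring)
    rw [hform a b w hxw hyw, map_smul_add_smul_add hx hy hxw hyw, hxy]
    simp only [map_div₀, map_neg, map_one, map_add, map_mul, Units.val_mk0] at h1 ⊢
    field_simp at h1 ⊢
    linear_combination h1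

end Semilinear

/-! ### The semidirect product and the automorphism group -/

section Automorphisms

variable {F V : Type*} [Field F] [AddCommGroup V] [Module F V] {κ : QuadraticForm F V}

theorem adj_iff_of_map_sub_eq_zero_iff {φ : Equiv.Perm V}
    (hφ : ∀ u v, κ (φ u - φ v) = 0 ↔ κ (u - v) = 0) (u v : V) :
    (affinePolarGraph κ).Adj (φ u) (φ v) ↔ (affinePolarGraph κ).Adj u v := by
  simp only [affinePolarGraph, hφ, Ne, φ.injective.eq_iff]

theorem map_sub_eq_zero_iff_of_iso (ψ : affinePolarGraph κ ≃g affinePolarGraph κ) (u v : V) :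
    κ (ψ u - ψ v) = 0 ↔ κ (u - v) = 0 := by
  by_cases huv : u = v
  · simp [huv]
  have h : (ψ u ≠ ψ v ∧ κ (ψ u - ψ v) = 0) ↔ (u ≠ v ∧ κ (u - v) = 0) := ψ.map_rel_iff
  simpa [huv] using h

/-- The affine automorphism `x ↦ g x + v` of the affine polar graph. -/
def affineIso (κ : QuadraticForm F V) (v : V) (g : semisimilarityGroup κ) :
    affinePolarGraph κ ≃g affinePolarGraph κ where
  toEquiv := (g : Equiv.Perm V).trans (Equiv.addRight v)
  map_rel_iff' {a b} := by
    refine adj_iff_of_map_sub_eq_zero_iff (fun a b => ?_) a b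
    obtain ⟨g, ⟨hadd, -⟩, l, α, hα⟩ := g
    have hsub : g a - g b = g (a - b) := by
      rw [sub_eq_iff_eq_add, ← hadd, sub_add_cancel]
    simp [hsub, hα]

@[simp]
theorem affineIso_apply (v : V) (g : semisimilarityGroup κ) (x : V) :
    affineIso κ v g x = (g : Equiv.Perm V) x + v := rfl

/-- The semidirect product of translations and semisimilarities acting on the graph. -/
def affineIsoHom (κ : QuadraticForm F V) :
    Multiplicative V ⋊[semisimilarityAction κ] semisimilarityGroup κ →*
      (affinePolarGraph κ ≃g affinePolarGraph κ) where
  toFun p := affineIso κ p.left.toAdd p.right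
  map_one' := by
    ext x
    simp
  map_mul' p q := by
    ext x
    have h := p.right.2.1.1
    change (p.right : Equiv.Perm V) ((q.right : Equiv.Perm V) x) +
        (p.left.toAdd + (p.right : Equiv.Perm V) q.left.toAdd) =
      (p.right : Equiv.Perm V) ((q.right : Equiv.Perm V) x + q.left.toAdd) + p.left.toAdd
    rw [h]
    abel

theorem affineIsoHom_injective : Function.Injective (affineIsoHom κ) := by
  intro p q h
  have h' : ∀ x, (p.right : Equiv.Perm V) x + p.left.toAdd =
      (q.right : Equiv.Perm V) x + q.left.toAdd := fun x => DFunLike.congr_fun h x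
  have hzero : ∀ g : semisimilarityGroup κ, (g : Equiv.Perm V) 0 = 0 := fun g => by
    simpa using g.2.1.1 0 0
  have hl : p.left.toAdd = q.left.toAdd := by simpa [hzero] using h' 0
  refine SemidirectProduct.ext hl (Subtype.ext (Equiv.ext fun x => ?_))
  simpa [hl] using h' x

/-- An automorphism of the graph fixing the zero vector is a semisimilarity. -/
theorem mem_semisimilarityGroup [Finite F] [FiniteDimensional F V]
    (hκ : ∀ x, (∀ y, polar κ x y = 0) → x = 0) (hdim : 2 < Module.finrank F V)
    (hsing : ∃ x, κ x = 0 ∧ x ≠ 0) {φ : Equiv.Perm V}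
    (hφ : ∀ u v, κ (φ u - φ v) = 0 ↔ κ (u - v) = 0) (hφ0 : φ 0 = 0) :
    φ ∈ semisimilarityGroup κ := by
  have hadd := image_add hκ hdim hsing hφ hφ0
  obtain ⟨σ, l, hσ, hl⟩ := exists_semisimilarity hκ hdim hsing (AddEquiv.mk φ hadd)
    (fun v hv => by simpa [hφ0, hv] using hφ v 0)
    (fun x z hx => by
      have h := polar_eq_zero_iff_image hκ hφ hx 0 z
      simp only [hφ0, sub_zero, zero_add] at h
      rw [polar_comm κ x, ← h, polar_comm]
      rfl)
    (fun x hx c => by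
      obtain ⟨d, hd⟩ := (exists_eq_add_smul_iff_image hκ hφ hx 0 (c • x)).mp ⟨c, by simp⟩
      exact ⟨d, by simpa [hφ0] using hd⟩)
  exact ⟨⟨hadd, σ, hσ⟩, l, σ, hl⟩

theorem affineIsoHom_surjective [Finite F] [FiniteDimensional F V]
    (hκ : ∀ x, (∀ y, polar κ x y = 0) → x = 0) (hdim : 2 < Module.finrank F V)
    (hsing : ∃ x, κ x = 0 ∧ x ≠ 0) : Function.Surjective (affineIsoHom κ) := by
  intro ψ
  let φ : Equiv.Perm V := ψ.toEquiv.trans (Equiv.subRight (ψ 0))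
  have hφ : φ ∈ semisimilarityGroup κ :=
    mem_semisimilarityGroup hκ hdim hsing
      (fun u v => by simpa [φ] using map_sub_eq_zero_iff_of_iso ψ u v) (by simp [φ])
  refine ⟨⟨Multiplicative.ofAdd (ψ 0), φ, hφ⟩, RelIso.ext fun x => ?_⟩
  change ψ x - ψ 0 + ψ 0 = ψ x
  exact sub_add_cancel _ _

end Automorphisms

theorem IsNonsingularOfType.exists_singular {F V : Type*} [Field F] [AddCommGroup V] [Module F V]
    {κ : QuadraticForm F V} {m : ℕ} {ε : FormSign} (hm : 2 ≤ m)
    (hκ : IsNonsingularOfType κ m ε) : ∃ x, κ x = 0 ∧ x ≠ 0 := by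
  obtain ⟨W, hW, hfin⟩ := hκ.wittIndex.1
  -- In the minus case the index is `m - 1`, positive because `2 ≤ m`.
  have hpos : 0 < ε.wittIndex m := by
    cases ε <;> simp only [FormSign.wittIndex] <;> omega
  have hne : W ≠ ⊥ := by
    rintro rfl
    rw [finrank_bot] at hfin
    omega
  obtain ⟨x, hxW, hx0⟩ := W.exists_mem_ne_zero_of_ne_bot hne
  exact ⟨x, hW x hxW, hx0⟩

end AffinePolar

theorem proposition3p10 {F V : Type*} [Field F] [Finite F] [AddCommGroup V] [Module F V]
    (m : ℕ) (hm : 2 ≤ m) (ε : AffinePolar.FormSign) (κ : QuadraticForm F V)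
    (hκ : AffinePolar.IsNonsingularOfType κ m ε) :
    ∃ e : Multiplicative V ⋊[AffinePolar.semisimilarityAction κ] AffinePolar.semisimilarityGroup κ ≃*
        (AffinePolar.affinePolarGraph κ ≃g AffinePolar.affinePolarGraph κ),
      ∀ (v : V) (g : AffinePolar.semisimilarityGroup κ) (x : V),
        e ⟨Multiplicative.ofAdd v, g⟩ x = (g : Equiv.Perm V) x + v := by
  have hfin : FiniteDimensional F V :=
    Module.finite_of_finrank_pos (by rw [hκ.finrank_eq]; omega)
  have hnd : ∀ x, (∀ y, QuadraticMap.polar κ x y = 0) → x = 0 := fun x hx =>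
    AffinePolar.eq_zero_of_polar_eq_zero hκ.radical_eq_bot
      (by rw [hκ.finrank_eq]; exact even_two_mul m) hx
  exact ⟨MulEquiv.ofBijective (AffinePolar.affineIsoHom κ)
    ⟨AffinePolar.affineIsoHom_injective, AffinePolar.affineIsoHom_surjective hnd
      (by rw [hκ.finrank_eq]; omega) (hκ.exists_singular hm)⟩, fun v g x => rfl⟩
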